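/- A set $N\subseteq\mathbb R^n$ is called a submanifold if it is an embedded smooth ($C^\infty$) submanifold; its components may have different dimensions. A smooth function $f:\mathbb R^n\to\mathbb R$ is called Morse--Bott if its set of critical points is a disjoint union of submanifolds $N_i$ such that, for every $i$ and every $x\in N_i$, the restriction of the Hessian of $f$ at $x$ to the normal space $(T_xN_i)^\perp$ is a non-degenerate bilinear form. Let $f:\mathbb R^n\to\mathbb R$ be a non-negative Morse--Bott function such that $f^{-1}(0)$ is a non-empty submanifold of $\mathbb R^n$. Let $-\infty\le a<\infty$, and let $\gamma:(a,\infty)\to\mathbb R^n$ be a gradient flow of $f$, i.e. $\dot\gamma(t)=-\nabla f(\gamma(t))$ for all $t>a$, with $\lim_{t\to\infty}\gamma(t)=p\in f^{-1}(0)$. Let $\mathcal P$ be the orthogonal projection of $\mathbb R^n$ onto the tangent space $T_pf^{-1}(0)$, and $\mathcal Q=I-\mathcal P$. Then there is a constant $C$ (which may depend on $f$ and $\gamma$) such that $$|\mathcal P(\gamma(t)-p)|\le C\,|\mathcal Q(\gamma(t)-p)|^2\qquad\text{for all sufficiently large } t .$$ Moreover, if $\gamma$ is not constant, then $\mathcal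 Q(\gamma(t)-p)\neq 0$ for all sufficiently large $t$, and $$\limsup_{t\to\infty}\frac{|\mathcal P(\gamma(t)-p)|}{|\mathcal Q(\gamma(t)-p)|^2}<\infty .$$ -/

import Mathlib

open Filter Topology
open scoped ContDiff

namespace MorseBott

/-- `N` is an embedded smooth submanifold of `E`: around each of its points there is a smooth
diffeomorphism between open subsets of `E` that straightens `N` to a linear subspace. (Different
connected components are allowed to have different dimensions.) -/
def IsSubmanifold {E : Type*} [NormedAddCommGroup E] [NormedSpace ℝ E] (N : Set E) : Prop :=
  ∀ x ∈ N, ∃ (e : OpenPartialHomeomorph E E) (F : Submodule ℝ E),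
    x ∈ e.source ∧ ContDiffOn ℝ ∞ e e.source ∧ ContDiffOn ℝ ∞ e.symm e.target ∧
      e '' (e.source ∩ N) = e.target ∩ (F : Set E)

/-- The velocities at `x` of smooth curves through `x` that stay in `N`. -/
def velocities {E : Type*} [NormedAddCommGroup E] [NormedSpace ℝ E] (N : Set E) (x : E) :
    Set E :=
  {v | ∃ c : ℝ → E, ContDiffAt ℝ ∞ c 0 ∧ c 0 = x ∧ (∀ᶠ t in 𝓝 (0 : ℝ), c t ∈ N) ∧
    HasDerivAt c v 0}

/-- The tangent space `T_x N`. If `N` is a submanifold and `x ∈ N`, the velocities already form a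
linear subspace, see `coe_tangentSpace`; the span only serves to have a subspace in all cases. -/
def tangentSpace {E : Type*} [NormedAddCommGroup E] [NormedSpace ℝ E] (N : Set E) (x : E) :
    Submodule ℝ E :=
  Submodule.span ℝ (velocities N x)

theorem coe_tangentSpace {E : Type*} [NormedAddCommGroup E] [NormedSpace ℝ E]
    [FiniteDimensional ℝ E] {N : Set E}
    (hN : IsSubmanifold N) {x : E} (hx : x ∈ N) :
    (tangentSpace N x : Set E) = velocities N x := by
  refine Set.Subset.antisymm ?_ Submodule.subset_span
  obtain ⟨e, F, hxe, he, hes, himg⟩ := hN x hx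
  have heA : ContDiffAt ℝ ∞ e x := he.contDiffAt (e.open_source.mem_nhds hxe)
  have hesA : ContDiffAt ℝ ∞ e.symm (e x) :=
    hes.contDiffAt (e.open_target.mem_nhds (e.map_source hxe))
  have hD : HasFDerivAt e (fderiv ℝ e x) x := (heA.differentiableAt (by simp)).hasFDerivAt
  have hDs : HasFDerivAt e.symm (fderiv ℝ e.symm (e x)) (e x) :=
    (hesA.differentiableAt (by simp)).hasFDerivAt
  have hinv : ∀ v, fderiv ℝ e.symm (e x) (fderiv ℝ e x v) = v := by
    intro v
    have h1 := hDs.comp x hD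
    have h2 : HasFDerivAt (e.symm ∘ e) (ContinuousLinearMap.id ℝ E) x :=
      (hasFDerivAt_id x).congr_of_eventuallyEq
        (by filter_upwards [e.open_source.mem_nhds hxe] with y hy using e.left_inv hy)
    simpa using DFunLike.congr_fun (h1.unique h2) v
  have hex : e x ∈ F := (himg.subset ⟨x, ⟨hxe, hx⟩, rfl⟩).2
  have hcurve : ∀ w ∈ F, fderiv ℝ e.symm (e x) w ∈ velocities N x := by
    intro w hw
    have hl : ContDiffAt ℝ ∞ (fun t : ℝ => e x + t • w) 0 := by fun_prop
    have hl' : HasDerivAt (fun t : ℝ => e x + t • w) w 0 := by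
      simpa using ((hasDerivAt_id (0 : ℝ)).smul_const w).const_add (e x)
    refine ⟨fun t => e.symm (e x + t • w), ?_, by simp [e.left_inv hxe], ?_, ?_⟩
    · exact ContDiffAt.comp (0 : ℝ) (g := e.symm) (by simpa using hesA) hl
    · have : ∀ᶠ t in 𝓝 (0 : ℝ), e x + t • w ∈ e.target :=
        hl.continuousAt.eventually_mem
          (by simpa using e.open_target.mem_nhds (e.map_source hxe))
      filter_upwards [this] with t ht
      obtain ⟨y, ⟨hy, hyN⟩, hye⟩ := himg.superset ⟨ht, F.add_mem hex (F.smul_mem t hw)⟩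
      rw [← hye, e.left_inv hy]
      exact hyN
    · exact HasFDerivAt.comp_hasDerivAt (0 : ℝ) (l := e.symm) (by simpa using hDs) hl'
  have hF : ∀ v ∈ velocities N x, fderiv ℝ e x v ∈ F := by
    rintro v ⟨c, hc, rfl, hcN, hcv⟩
    have h1 : HasDerivAt (fun t => e (c t)) (fderiv ℝ e (c 0) v) 0 :=
      hD.comp_hasDerivAt (0 : ℝ) hcv
    refine (F.closed_of_finiteDimensional).mem_of_tendsto h1.tendsto_slope ?_
    refine Filter.Eventually.filter_mono nhdsWithin_le_nhds ?_
    filter_upwards [hcN, hc.continuousAt.eventually_mem (e.open_source.mem_nhds hxe)]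
      with t ht hts
    rw [slope_def_module]
    exact F.smul_mem _ (F.sub_mem (himg.subset ⟨_, ⟨hts, ht⟩, rfl⟩).2 hex)
  have hle : tangentSpace N x ≤ F.map (fderiv ℝ e.symm (e x)).toLinearMap :=
    Submodule.span_le.2 fun v hv => ⟨fderiv ℝ e x v, hF v hv, hinv v⟩
  intro v hv
  obtain ⟨w, hw, rfl⟩ := hle hv
  exact hcurve w hw

/-- The set of critical points of `f`. -/
def criticalSet {E : Type*} [NormedAddCommGroup E] [NormedSpace ℝ E] (f : E → ℝ) : Set E :=
  {x | fderiv ℝ f x = 0}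

/-- `N` is a non-degenerate critical manifold of `f`: a submanifold consisting of critical points
such that at each `x ∈ N` the Hessian of `f`, restricted to the normal space `(T_x N)ᗮ`, is a
non-degenerate bilinear form. -/
def IsNondegenerateCriticalManifold {E : Type*} [NormedAddCommGroup E] [InnerProductSpace ℝ E]
    (f : E → ℝ) (N : Set E) : Prop :=
  IsSubmanifold N ∧ N ⊆ criticalSet f ∧
    ∀ x ∈ N, ∀ v ∈ (tangentSpace N x)ᗮ,
      (∀ w ∈ (tangentSpace N x)ᗮ, fderiv ℝ (fderiv ℝ f) x v w = 0) → v = 0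

/-- `f` is Morse–Bott: it is smooth and its critical set is a disjoint union of non-degenerate
critical manifolds. -/
def IsMorseBott {E : Type*} [NormedAddCommGroup E] [InnerProductSpace ℝ E] (f : E → ℝ) : Prop :=
  ContDiff ℝ ∞ f ∧
    ∃ 𝒩 : Set (Set E), 𝒩.PairwiseDisjoint id ∧ ⋃₀ 𝒩 = criticalSet f ∧
      ∀ N ∈ 𝒩, IsNondegenerateCriticalManifold f N

/-- `γ` is a gradient flow of `f` on the interval `(a, b)`, where `-∞ ≤ a < b ≤ ∞`: it satisfies
`γ' = -∇f(γ)` there. Values of `γ` outside `(a, b)` are irrelevant. -/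
structure IsGradientFlow {E : Type*} [NormedAddCommGroup E] [InnerProductSpace ℝ E]
    [CompleteSpace E] (f : E → ℝ) (γ : ℝ → E) (a b : EReal) : Prop where
  lt : a < b
  hasDerivAt : ∀ t : ℝ, a < (t : EReal) → (t : EReal) < b →
    HasDerivAt γ (-gradient f (γ t)) t

end MorseBott

/-! Let $T=T_pf^{-1}(0)$, $X(t)=\mathcal P(\gamma(t)-p)$ and $\varphi(t)=f(\gamma(t))$. The Hessian
at $p$ vanishes on $T$ and, by the Morse–Bott condition and minimality, is coercive on $T^\perp$.
Comparing $w$ near $p$ with a zero $q$ of $f$ such that $w-q\perp T$ gives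
(`exists_eventually_gradient_estimates`) $\kappa f\le|\nabla f|^2$, $|\mathcal P\nabla f(w)|\le
C(\sqrt{f(w)}\,|\mathcal P(w-p)|+f(w))$ and $f(w)\le C|w-p|^2$.

By the first bound $\varphi$ decays exponentially. Integrating $\dot X$ over $[t,\infty)$ with the
second, and absorbing the term with the small factor $\sqrt{\varphi}$, gives $|X|\le K\varphi$
(`exists_eventually_norm_le_mul`). The third then gives $|X|\le KC(|X|+|\mathcal Q(\gamma-p)|)^2$,
where the quadratic term in $X$ is absorbed because $X\to0$.

If $\mathcal Q(\gamma-p)$ vanished at a late time, so would $X$; the flow would sit at the critical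
point $p$ and be constant by ODE uniqueness. -/

namespace MorseBott

/-! ### The Hessian at minima and along critical manifolds -/

section Hessian

variable {E : Type*} [NormedAddCommGroup E] [InnerProductSpace ℝ E]

/-- A negative second derivative along a line would make $p$ a local maximum there as well as a
minimum, so $f$ would be locally constant on the line and the second derivative zero. -/
theorem second_fderiv_nonneg_of_isLocalMin {f : E → ℝ} (hf : ContDiff ℝ ∞ f) {p : E}
    (hmin : IsLocalMin f p) (v : E) : 0 ≤ fderiv ℝ (fderiv ℝ f) p v v := by
  have hl : ∀ t : ℝ, HasDerivAt (fun t : ℝ => p + t • v) v t := fun t => by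
    simpa using ((hasDerivAt_id t).smul_const v).const_add p
  have hfd : ContDiff ℝ ∞ (fderiv ℝ f) := hf.fderiv_right (by simp)
  have h1 : ∀ t : ℝ, HasDerivAt (fun t : ℝ => f (p + t • v)) (fderiv ℝ f (p + t • v) v) t :=
    fun t => ((hf.differentiable (by simp)) _).hasFDerivAt.comp_hasDerivAt t (hl t)
  have h2 : HasDerivAt (fun t : ℝ => fderiv ℝ f (p + t • v) v) (fderiv ℝ (fderiv ℝ f) p v v) 0 := by
    have h := ((hfd.differentiable (by simp)) (p + (0 : ℝ) • v)).hasFDerivAt.comp_hasDerivAt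
      (0 : ℝ) (hl 0)
    simpa using h.clm_apply (hasDerivAt_const (0 : ℝ) v)
  have hd : deriv (fun t : ℝ => f (p + t • v)) = fun t : ℝ => fderiv ℝ f (p + t • v) v :=
    funext fun t => (h1 t).deriv
  by_contra! hneg
  have hmax : IsLocalMax (fun t : ℝ => f (p + t • v)) 0 := by
    refine isLocalMax_of_deriv_deriv_neg ?_ ?_ (h1 0).continuousAt
    · rwa [hd, h2.deriv]
    · rw [hd]
      simp [hmin.fderiv_eq_zero]
  have hmin' : ∀ᶠ t in 𝓝 (0 : ℝ), f p ≤ f (p + t • v) := by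
    have : Tendsto (fun t : ℝ => p + t • v) (𝓝 0) (𝓝 p) := by
      simpa using (hl 0).continuousAt.tendsto
    exact this.eventually hmin
  have hconst : (fun t : ℝ => f (p + t • v)) =ᶠ[𝓝 0] fun _ => f p := by
    filter_upwards [hmax, hmin'] with t h3 h4
    simp only [zero_smul, add_zero] at h3
    exact le_antisymm h3 h4
  have h5 := hconst.deriv.deriv_eq
  rw [hd, h2.deriv] at h5
  simp at h5
  exact hneg.ne h5

theorem bilin_eq_zero_of_self_eq_zero {B : E →L[ℝ] E →L[ℝ] ℝ} (hsymm : ∀ v w, B v w = B w v)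
    (hB : ∀ v, 0 ≤ B v v) {v : E} (hv : B v v = 0) (w : E) : B v w = 0 := by
  by_contra h
  -- The coefficient is chosen so that the form takes the value $-1$ at this vector.
  have h1 := hB (w + (-(B w w + 1) / (2 * B v w)) • v)
  simp only [map_add, map_smul, add_apply, smul_apply,
    smul_eq_mul, hv, hsymm w v] at h1
  have h2 : (-(B w w + 1) / (2 * B v w)) * B v w = -(B w w + 1) / 2 := by field_simp
  linarith

theorem fderiv_fderiv_symm {f : E → ℝ} (hf : ContDiff ℝ ∞ f) (p v w : E) :
    fderiv ℝ (fderiv ℝ f) p v w = fderiv ℝ (fderiv ℝ f) p w v :=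
  (hf.contDiffAt (x := p)).isSymmSndFDerivAt
    (by simpa using WithTop.coe_le_coe.2 (le_top (a := (2 : ℕ∞)))) v w

theorem fderiv_fderiv_eq_zero_of_mem_tangentSpace {f : E → ℝ} (hf : ContDiff ℝ ∞ f) {N : Set E}
    (hN : N ⊆ criticalSet f) {p v : E} (hv : v ∈ tangentSpace N p) :
    fderiv ℝ (fderiv ℝ f) p v = 0 := by
  have hfd : ContDiff ℝ ∞ (fderiv ℝ f) := hf.fderiv_right (by simp)
  suffices h : tangentSpace N p ≤ LinearMap.ker (fderiv ℝ (fderiv ℝ f) p).toLinearMap from h hv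
  refine Submodule.span_le.2 ?_
  rintro v ⟨c, -, rfl, hcN, hcv⟩
  have h1 : HasDerivAt (fun t => fderiv ℝ f (c t)) (fderiv ℝ (fderiv ℝ f) (c 0) v) 0 :=
    ((hfd.differentiable (by simp)) (c 0)).hasFDerivAt.comp_hasDerivAt (0 : ℝ) hcv
  have h2 : (fun t => fderiv ℝ f (c t)) =ᶠ[𝓝 0] fun _ => 0 := by
    filter_upwards [hcN] with t ht using hN ht
  exact h1.unique ((hasDerivAt_const (0 : ℝ) (0 : E →L[ℝ] ℝ)).congr_of_eventuallyEq h2)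

/-- Along a curve of critical points $f$ is constant, so a curve in `N` through a zero stays in the
zero set. This passes from the critical manifold, where non-degeneracy is assumed, to $f^{-1}(0)$.
-/
theorem tangentSpace_le_of_subset_criticalSet {f : E → ℝ} (hf : ContDiff ℝ ∞ f) {N : Set E}
    (hN : N ⊆ criticalSet f) {p : E} (hp : f p = 0) :
    tangentSpace N p ≤ tangentSpace (f ⁻¹' {0}) p := by
  refine Submodule.span_mono ?_
  rintro v ⟨c, hc, rfl, hcN, hcv⟩
  refine ⟨c, hc, rfl, ?_, hcv⟩
  have hd : ∀ᶠ t in 𝓝 (0 : ℝ), DifferentiableAt ℝ c t := by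
    filter_upwards [(hc.of_le (m := 1) (by simp)).eventually (by simp)] with t ht
      using ht.differentiableAt (by simp)
  obtain ⟨ε, hε, hball⟩ := Metric.eventually_nhds_iff_ball.1 (hd.and hcN)
  have hderiv : ∀ t ∈ Metric.ball (0 : ℝ) ε,
      HasFDerivWithinAt (fun t => f (c t)) (0 : ℝ →L[ℝ] ℝ) (Metric.ball 0 ε) t := by
    intro t ht
    have h1 := ((hf.differentiable (by simp)) (c t)).hasFDerivAt.comp t (hball t ht).1.hasFDerivAt
    have h2 : fderiv ℝ f (c t) = 0 := hN (hball t ht).2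
    rw [h2, ContinuousLinearMap.zero_comp] at h1
    exact h1.hasFDerivWithinAt
  filter_upwards [Metric.ball_mem_nhds (0 : ℝ) hε] with t ht
  have h3 := (convex_ball (0 : ℝ) ε).norm_image_sub_le_of_norm_hasFDerivWithin_le (C := 0) hderiv
    (by simp) (Metric.mem_ball_self hε) ht
  have h4 : f (c t) - f (c 0) = 0 := by simpa using h3
  rw [hp, sub_zero] at h4
  exact h4

end Hessian

section Gradient

variable {E : Type*} [NormedAddCommGroup E] [InnerProductSpace ℝ E] [CompleteSpace E]

theorem inner_gradient (f : E → ℝ) (x v : E) : inner ℝ (gradient f x) v = fderiv ℝ f x v := by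
  simp [gradient]

theorem gradient_eq_zero_iff (f : E → ℝ) (x : E) : gradient f x = 0 ↔ fderiv ℝ f x = 0 := by
  simp [gradient]

theorem contDiff_gradient {f : E → ℝ} (hf : ContDiff ℝ ∞ f) : ContDiff ℝ ∞ (gradient f) :=
  (InnerProductSpace.toDual ℝ E).symm.contDiff.comp (hf.fderiv_right (by simp))

theorem inner_fderiv_gradient {f : E → ℝ} (hf : ContDiff ℝ ∞ f) (x v w : E) :
    inner ℝ (fderiv ℝ (gradient f) x v) w = fderiv ℝ (fderiv ℝ f) x v w := by
  have hfd : ContDiff ℝ ∞ (fderiv ℝ f) := hf.fderiv_right (by simp)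
  have h1 := (((contDiff_gradient hf).differentiable (by simp)) x).hasFDerivAt.inner ℝ
    (hasFDerivAt_const w x)
  have h2 := ((hfd.differentiable (by simp)) x).hasFDerivAt.clm_apply (hasFDerivAt_const w x)
  simp only [inner_gradient] at h1
  simpa using DFunLike.congr_fun (h1.unique h2) v

end Gradient

/-! ### Coercivity on the normal space; normal slices of the zero set -/

section Coercive

variable {E : Type*} [NormedAddCommGroup E] [InnerProductSpace ℝ E] [FiniteDimensional ℝ E]

theorem exists_pos_mul_sq_le {B : E →L[ℝ] E →L[ℝ] ℝ} {S : Submodule ℝ E}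
    (hB : ∀ v ∈ S, v ≠ 0 → 0 < B v v) : ∃ c > 0, ∀ v ∈ S, c * ‖v‖ ^ 2 ≤ B v v := by
  have hcomp : IsCompact (Metric.sphere (0 : E) 1 ∩ S) :=
    (isCompact_sphere 0 1).inter_right S.closed_of_finiteDimensional
  have hcont : Continuous fun v => B v v := B.continuous.clm_apply continuous_id
  rcases (Metric.sphere (0 : E) 1 ∩ S).eq_empty_or_nonempty with hempty | hne
  · refine ⟨1, one_pos, fun v hv => ?_⟩
    rcases eq_or_ne v 0 with rfl | h0
    · simp
    · have : ‖v‖⁻¹ • v ∈ Metric.sphere (0 : E) 1 ∩ S :=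
        ⟨by simp [norm_smul, h0], S.smul_mem _ hv⟩
      rw [hempty] at this
      exact this.elim
  · obtain ⟨u, hu, hmin⟩ := hcomp.exists_isMinOn hne hcont.continuousOn
    have hu0 : u ≠ 0 := by
      rintro rfl
      simpa using hu.1
    refine ⟨B u u, hB u hu.2 hu0, fun v hv => ?_⟩
    rcases eq_or_ne v 0 with rfl | h0
    · simp
    · have h1 : ‖v‖⁻¹ • v ∈ Metric.sphere (0 : E) 1 ∩ S :=
        ⟨by simp [norm_smul, h0], S.smul_mem _ hv⟩
      have h2 : B u u ≤ B (‖v‖⁻¹ • v) (‖v‖⁻¹ • v) := hmin h1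
      have h3 : 0 < ‖v‖ := norm_pos_iff.2 h0
      simp only [map_smul, smul_apply, smul_eq_mul] at h2
      field_simp at h2
      linarith

/-- The Hessian of a non-negative Morse–Bott function at a zero is positive definite on the normal
space of the zero set. -/
theorem exists_pos_mul_sq_le_hessian {f : E → ℝ} (hf : IsMorseBott f) (hf0 : ∀ x, 0 ≤ f x)
    {p : E} (hp : f p = 0) :
    ∃ c > 0, ∀ v ∈ (tangentSpace (f ⁻¹' {0}) p)ᗮ,
      c * ‖v‖ ^ 2 ≤ fderiv ℝ (fderiv ℝ f) p v v := by
  obtain ⟨hsm, 𝒩, -, hunion, hnd⟩ := hf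
  have hmin : IsLocalMin f p := Eventually.of_forall fun x => hp.trans_le (hf0 x)
  obtain ⟨N, hN, hpN⟩ : p ∈ ⋃₀ 𝒩 := hunion ▸ hmin.fderiv_eq_zero
  obtain ⟨-, hcrit, hker⟩ := hnd N hN
  refine exists_pos_mul_sq_le fun v hv hv0 =>
    (second_fderiv_nonneg_of_isLocalMin hsm hmin v).lt_of_ne' fun h => hv0 ?_
  -- A vector on which a semidefinite form vanishes lies in its kernel; being normal to the zero
  -- set, it is also normal to `N`, so non-degeneracy applies.
  exact hker p hpN v
    (Submodule.orthogonal_le (tangentSpace_le_of_subset_criticalSet hsm hcrit hp) hv)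
    fun w _ => bilin_eq_zero_of_self_eq_zero (fderiv_fderiv_symm hsm p)
      (second_fderiv_nonneg_of_isLocalMin hsm hmin) h w

/-- Near `x`, the affine normal spaces to `T_x N` meet the submanifold `N` close to `x`. -/
theorem IsSubmanifold.eventually_exists_sub_mem_orthogonal {N : Set E} (hN : IsSubmanifold N)
    {x : E} (hx : x ∈ N) {V : Set E} (hV : V ∈ 𝓝 x) :
    ∀ᶠ w in 𝓝 x, ∃ q ∈ N ∩ V, w - q ∈ (tangentSpace N x)ᗮ := by
  obtain ⟨e, F, hxe, he, hes, himg⟩ := hN x hx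
  have heA : ContDiffAt ℝ ∞ e x := he.contDiffAt (e.open_source.mem_nhds hxe)
  have hesA : ContDiffAt ℝ ∞ e.symm (e x) :=
    hes.contDiffAt (e.open_target.mem_nhds (e.map_source hxe))
  have hD : HasFDerivAt e (fderiv ℝ e x) x := (heA.differentiableAt (by simp)).hasFDerivAt
  have hDs : HasStrictFDerivAt e.symm (fderiv ℝ e.symm (e x)) (e x) :=
    hesA.hasStrictFDerivAt (by simp)
  have hinv : ∀ v, fderiv ℝ e.symm (e x) (fderiv ℝ e x v) = v := by
    intro v
    have h1 := hDs.hasFDerivAt.comp x hD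
    have h2 : HasFDerivAt (e.symm ∘ e) (ContinuousLinearMap.id ℝ E) x :=
      (hasFDerivAt_id x).congr_of_eventuallyEq
        (by filter_upwards [e.open_source.mem_nhds hxe] with y hy using e.left_inv hy)
    simpa using DFunLike.congr_fun (h1.unique h2) v
  have hex : e x ∈ F := (himg.subset ⟨x, ⟨hxe, hx⟩, rfl⟩).2
  have hF : ∀ v ∈ velocities N x, fderiv ℝ e x v ∈ F := by
    rintro v ⟨c, hc, rfl, hcN, hcv⟩
    have h1 : HasDerivAt (fun t => e (c t)) (fderiv ℝ e (c 0) v) 0 :=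
      hD.comp_hasDerivAt (0 : ℝ) hcv
    refine (F.closed_of_finiteDimensional).mem_of_tendsto h1.tendsto_slope ?_
    refine Filter.Eventually.filter_mono nhdsWithin_le_nhds ?_
    filter_upwards [hcN, hc.continuousAt.eventually_mem (e.open_source.mem_nhds hxe)]
      with t ht hts
    rw [slope_def_module]
    exact F.smul_mem _ (F.sub_mem (himg.subset ⟨_, ⟨hts, ht⟩, rfl⟩).2 hex)
  set T := tangentSpace N x with hT
  have hTF : ∀ v ∈ T, fderiv ℝ e x v ∈ F := fun v hv =>
    (Submodule.span_le (p := F.comap (fderiv ℝ e x).toLinearMap)).2 hF hv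
  let j : F → E := fun u => e x + u
  have hj : HasStrictFDerivAt j F.subtypeL 0 := F.subtypeL.hasStrictFDerivAt.const_add (e x)
  have hj0 : j 0 = e x := by simp [j]
  -- `N` is parametrized by `F` and projected to the fixed space `T`. The derivative at 0 is onto,
  -- so images of neighbourhoods of 0 are neighbourhoods of 0, and every `w` near `x` shares its
  -- projection with a nearby point of `N`.
  let h : F → T := fun u => T.orthogonalProjectionOnto (e.symm (j u) - x)
  have hh : HasStrictFDerivAt h
      (T.orthogonalProjectionOnto ∘L (fderiv ℝ e.symm (e x)) ∘L F.subtypeL) 0 := by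
    have h1 : HasStrictFDerivAt e.symm (fderiv ℝ e.symm (e x)) (j 0) := hj0 ▸ hDs
    exact T.orthogonalProjectionOnto.hasStrictFDerivAt.comp 0 ((h1.comp 0 hj).sub_const x)
  have hsurj : (T.orthogonalProjectionOnto ∘L (fderiv ℝ e.symm (e x)) ∘L F.subtypeL).range = ⊤ := by
    refine LinearMap.range_eq_top.2 fun v => ⟨⟨fderiv ℝ e x v, hTF v v.2⟩, ?_⟩
    simp [hinv]
  have hmap := hh.map_nhds_eq_of_surj hsurj
  have hh0 : h 0 = 0 := by simp [h, hj0, e.left_inv hxe]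
  have hjc : Tendsto j (𝓝 0) (𝓝 (e x)) := hj0 ▸ hj.continuousAt.tendsto
  have hgood : ∀ᶠ u in 𝓝 (0 : F), e.symm (j u) ∈ N ∩ V := by
    have h1 : Tendsto (fun u => e.symm (j u)) (𝓝 0) (𝓝 x) := by
      have := hDs.continuousAt.tendsto.comp hjc
      rwa [e.left_inv hxe] at this
    filter_upwards [hjc (e.open_target.mem_nhds (e.map_source hxe)), h1 hV] with u hu huV
    obtain ⟨y, ⟨hy, hyN⟩, hye⟩ := himg.superset ⟨hu, F.add_mem hex u.2⟩
    refine ⟨?_, huV⟩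
    rw [← hye, e.left_inv hy]
    exact hyN
  have himage : h '' {u | e.symm (j u) ∈ N ∩ V} ∈ 𝓝 (0 : T) := by
    rw [← hh0, ← hmap]
    exact image_mem_map hgood
  have hproj : Tendsto (fun w => T.orthogonalProjectionOnto (w - x)) (𝓝 x) (𝓝 0) := by
    have : Continuous fun w => T.orthogonalProjectionOnto (w - x) := by fun_prop
    simpa using this.tendsto x
  filter_upwards [hproj himage] with w hw
  obtain ⟨u, hu, huw⟩ := hw
  refine ⟨e.symm (j u), hu, ?_⟩
  rw [← Submodule.orthogonalProjectionOnto_eq_zero_iff]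
  have : w - e.symm (j u) = (w - x) - (e.symm (j u) - x) := by abel
  rw [this, map_sub]
  exact sub_eq_zero.2 huw.symm

end Coercive

/-! ### Exponential decay and integration from infinity -/

section Decay

variable {E : Type*} [NormedAddCommGroup E] [NormedSpace ℝ E]

theorem le_mul_exp_of_deriv_le {φ φ' : ℝ → ℝ} {κ t₀ : ℝ}
    (hφ : ∀ t ≥ t₀, HasDerivAt φ (φ' t) t) (hφ' : ∀ t ≥ t₀, φ' t ≤ -κ * φ t)
    {t s : ℝ} (ht : t₀ ≤ t) (hts : t ≤ s) : φ s ≤ φ t * Real.exp (-κ * (s - t)) := by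
  have hderiv : ∀ u ≥ t₀, HasDerivAt (fun u => Real.exp (κ * u) * φ u)
      (Real.exp (κ * u) * κ * φ u + Real.exp (κ * u) * φ' u) u := fun u hu => by
    have h1 : HasDerivAt (fun u => Real.exp (κ * u)) (Real.exp (κ * u) * κ) u := by
      simpa using ((hasDerivAt_id u).const_mul κ).exp
    exact h1.mul (hφ u hu)
  have hanti : AntitoneOn (fun u => Real.exp (κ * u) * φ u) (Set.Ici t₀) := by
    refine antitoneOn_of_hasDerivWithinAt_nonpos (convex_Ici t₀)
      (fun u hu => (hderiv u hu).continuousAt.continuousWithinAt)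
      (fun u hu => (hderiv u (interior_subset hu)).hasDerivWithinAt) fun u hu => ?_
    have h1 := hφ' u (interior_subset hu)
    have h2 := Real.exp_pos (κ * u)
    nlinarith
  have h1 : Real.exp (κ * s) * φ s ≤ Real.exp (κ * t) * φ t := hanti ht (ht.trans hts) hts
  have h2 : Real.exp (-κ * (s - t)) = Real.exp (κ * t) / Real.exp (κ * s) := by
    rw [← Real.exp_sub]
    ring_nf
  rw [h2, mul_div_assoc', le_div_iff₀ (Real.exp_pos _)]
  linarith

theorem norm_le_of_norm_deriv_le_of_tendsto_zero {X X' : ℝ → E} {a b κ t : ℝ} (ha : 0 ≤ a)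
    (hb : 0 ≤ b) (hκ : 0 < κ) (hX : ∀ s ≥ t, HasDerivAt X (X' s) s)
    (hX' : ∀ s ≥ t, ‖X' s‖ ≤ a * Real.exp (-(κ / 2) * (s - t)) + b * Real.exp (-κ * (s - t)))
    (hlim : Tendsto X atTop (𝓝 0)) : ‖X t‖ ≤ 2 / κ * a + b / κ := by
  have hexp : ∀ l s : ℝ, HasDerivAt (fun s => Real.exp (-l * (s - t)))
      (Real.exp (-l * (s - t)) * -l) s := fun l s => by
    simpa using (((hasDerivAt_id s).sub_const t).const_mul (-l)).exp
  -- The primitive of the assumed majorant of `‖X'‖` that vanishes at `t`.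
  let B : ℝ → ℝ := fun s => 2 / κ * a * (1 - Real.exp (-(κ / 2) * (s - t))) +
    b / κ * (1 - Real.exp (-κ * (s - t)))
  have hB : ∀ s, HasDerivAt B
      (a * Real.exp (-(κ / 2) * (s - t)) + b * Real.exp (-κ * (s - t))) s := fun s => by
    refine ((((hexp (κ / 2) s).const_sub 1).const_mul (2 / κ * a)).add
      (((hexp κ s).const_sub 1).const_mul (b / κ))).congr_deriv ?_
    field_simp
  have hbound : ∀ s ≥ t, ‖X s - X t‖ ≤ 2 / κ * a + b / κ := by
    intro s hs
    have h1 := image_norm_le_of_norm_deriv_right_le_deriv_boundary (f := fun s => X s - X t)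
      (f' := X') (a := t) (b := s) (B := B)
      (fun u hu => ((hX u hu.1).continuousAt.sub continuousAt_const).continuousWithinAt)
      (fun u hu => ((hX u hu.1).sub_const _).hasDerivWithinAt) (by simp [B]) hB
      (fun u hu => hX' u hu.1) (Set.right_mem_Icc.2 hs)
    refine h1.trans ?_
    have h2 : 0 ≤ 2 / κ * a := by positivity
    have h3 : 0 ≤ b / κ := by positivity
    have h4 := Real.exp_pos (-(κ / 2) * (s - t))
    have h5 := Real.exp_pos (-κ * (s - t))
    simp only [B]
    nlinarith
  have h1 : Tendsto (fun s => ‖X s - X t‖) atTop (𝓝 ‖X t‖) := by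
    simpa using (hlim.sub_const (X t)).norm
  exact le_of_tendsto h1 (by filter_upwards [eventually_ge_atTop t] with s hs using hbound s hs)

theorem exists_eventually_norm_le_mul {φ φ' : ℝ → ℝ} {X X' : ℝ → E} {κ C t₀ : ℝ}
    (hκ : 0 < κ) (hC : 0 ≤ C) (hφ0 : ∀ t, 0 ≤ φ t)
    (hφ : ∀ t ≥ t₀, HasDerivAt φ (φ' t) t) (hφ' : ∀ t ≥ t₀, φ' t ≤ -κ * φ t)
    (hX : ∀ t ≥ t₀, HasDerivAt X (X' t) t)
    (hX' : ∀ t ≥ t₀, ‖X' t‖ ≤ C * (√(φ t) * ‖X t‖ + φ t))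
    (hφlim : Tendsto φ atTop (𝓝 0)) (hXlim : Tendsto X atTop (𝓝 0)) :
    ∃ K ≥ 0, ∀ᶠ t in atTop, ‖X t‖ ≤ K * φ t := by
  have hest : ∀ t ≥ t₀, ∀ M : ℝ, (∀ s ≥ t, ‖X s‖ ≤ M) →
      ‖X t‖ ≤ 2 / κ * (C * √(φ t) * M) + C * φ t / κ := by
    intro t ht M hM
    have hM0 : 0 ≤ M := (norm_nonneg _).trans (hM t le_rfl)
    have := hφ0 t
    refine norm_le_of_norm_deriv_le_of_tendsto_zero (by positivity) (by positivity) hκ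
      (fun s hs => hX s (ht.trans hs)) (fun s hs => ?_) hXlim
    have h1 := le_mul_exp_of_deriv_le hφ hφ' ht hs
    -- The square root decays at half the rate.
    have h2 : √(φ s) ≤ √(φ t) * Real.exp (-(κ / 2) * (s - t)) := by
      refine Real.sqrt_le_iff.2 ⟨by positivity, ?_⟩
      rw [mul_pow, Real.sq_sqrt (hφ0 t), ← Real.exp_nat_mul]
      convert h1 using 3
      push_cast
      ring
    calc ‖X' s‖ ≤ C * (√(φ s) * ‖X s‖ + φ s) := hX' s (ht.trans hs)
      _ ≤ C * (√(φ t) * Real.exp (-(κ / 2) * (s - t)) * M + φ t * Real.exp (-κ * (s - t))) := by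
        gcongr
        exact hM s hs
      _ = _ := by ring
  have hsmall : ∀ᶠ t in atTop, 2 / κ * (C * √(φ t)) < 1 / 2 := by
    have h1 : Tendsto (fun t => 2 / κ * (C * √(φ t))) atTop (𝓝 0) := by
      simpa using (hφlim.sqrt.const_mul C).const_mul (2 / κ)
    exact h1.eventually_lt_const (by norm_num)
  have hX1 : ∀ᶠ t in atTop, ‖X t‖ < 1 :=
    (tendsto_zero_iff_norm_tendsto_zero.1 hXlim).eventually_lt_const one_pos
  obtain ⟨t₁, ht₁⟩ := eventually_atTop.1 ((hsmall.and hX1).and (eventually_ge_atTop t₀))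
  refine ⟨2 * C / κ, by positivity, ?_⟩
  filter_upwards [eventually_ge_atTop t₁] with t ht
  have hbdd : BddAbove ((fun s => ‖X s‖) '' Set.Ici t) := by
    refine ⟨1, ?_⟩
    rintro _ ⟨s, hs, rfl⟩
    exact (ht₁ s (ht.trans hs)).1.2.le
  have hne : ((fun s => ‖X s‖) '' Set.Ici t).Nonempty := ⟨_, t, Set.self_mem_Ici, rfl⟩
  -- As `‖X‖` need not be monotone, absorption is applied to its supremum over the whole tail.
  set M := sSup ((fun s => ‖X s‖) '' Set.Ici t) with hMdef
  have hM : ∀ s ≥ t, ‖X s‖ ≤ M := fun s hs => le_csSup hbdd ⟨s, hs, rfl⟩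
  have hM0 : 0 ≤ M := (norm_nonneg _).trans (hM t le_rfl)
  have h1 : M ≤ 1 / 2 * M + C * φ t / κ := by
    refine csSup_le hne ?_
    rintro _ ⟨s, hs, rfl⟩
    obtain ⟨⟨h2, -⟩, h3⟩ := ht₁ s (ht.trans hs)
    have h4 : φ s ≤ φ t := by
      refine (le_mul_exp_of_deriv_le hφ hφ' (ht₁ t ht).2 hs).trans
        (mul_le_of_le_one_right (hφ0 t) (Real.exp_le_one_iff.2 ?_))
      have : 0 ≤ s - t := sub_nonneg.2 (Set.mem_Ici.1 hs)
      nlinarith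
    calc ‖X s‖ ≤ 2 / κ * (C * √(φ s) * M) + C * φ s / κ :=
          hest s h3 M fun u hu => hM u (le_trans hs hu)
      _ = 2 / κ * (C * √(φ s)) * M + C * φ s / κ := by ring
      _ ≤ 1 / 2 * M + C * φ t / κ := by gcongr
  have h2 : 2 * C / κ * φ t = 2 * (C * φ t / κ) := by ring
  linarith [hM t le_rfl]

end Decay

/-! ### Gradient estimates near a zero -/

section LocalEstimates

/-- Mean value inequality with a locally Lipschitz derivative. `L` does not depend on `r`, so the
radius may later be fitted to the two points. -/
theorem exists_norm_sub_sub_fderiv_le {E : Type*} [NormedAddCommGroup E] [NormedSpace ℝ E] {G : E → E} (hG : ContDiff ℝ ∞ G) (p : E) :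
    ∃ L ≥ 0, ∃ r₀ > 0, ∀ r ≤ r₀, ∀ a ∈ Metric.closedBall p r, ∀ b ∈ Metric.closedBall p r,
      ‖G a - G b - fderiv ℝ G p (a - b)‖ ≤ L * r * ‖a - b‖ := by
  have hG' : ContDiff ℝ ∞ (fderiv ℝ G) := hG.fderiv_right (by simp)
  obtain ⟨L, s, hs, hL⟩ := (hG'.contDiffAt (x := p)).of_le (m := 1) (by simp)
    |>.exists_lipschitzOnWith
  obtain ⟨r₀, hr₀, hrs⟩ := Metric.nhds_basis_closedBall.mem_iff.1 hs
  refine ⟨L, L.2, r₀, hr₀, fun r hr a ha b hb => ?_⟩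
  refine (convex_closedBall p r).norm_image_sub_le_of_norm_hasFDerivWithin_le'
    (fun x _ => ((hG.differentiable (by simp)) x).hasFDerivAt.hasFDerivWithinAt)
    (fun x hx => ?_) hb ha
  have h1 := hL.dist_le_mul x (hrs (Metric.closedBall_subset_closedBall hr hx)) p
    (mem_of_mem_nhds hs)
  rw [dist_eq_norm] at h1
  exact h1.trans (mul_le_mul_of_nonneg_left hx L.2)

section Segment

variable {E : Type*} [NormedAddCommGroup E] [InnerProductSpace ℝ E] [CompleteSpace E]

theorem le_mul_norm_sub_sq {f : E → ℝ} (hf : ContDiff ℝ ∞ f) {s : Set E} (hs : Convex ℝ s)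
    {M : ℝ} {q w : E} (hq : q ∈ s) (hw : w ∈ s) (hfq : f q = 0) (hM0 : 0 ≤ M)
    (hM : ∀ y ∈ s, ‖gradient f y‖ ≤ M * ‖y - q‖) : f w ≤ M * ‖w - q‖ ^ 2 := by
  -- In this ball the gradient is at most `M * ‖w - q‖`.
  have h1 : Convex ℝ (s ∩ Metric.closedBall q ‖w - q‖) := hs.inter (convex_closedBall _ _)
  have h2 := h1.norm_image_sub_le_of_norm_hasFDerivWithin_le (f := f) (C := M * ‖w - q‖)
    (fun x _ => ((hf.differentiable (by simp)) x).hasFDerivAt.hasFDerivWithinAt)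
    (fun x hx => ?_) (x := q) (y := w) ⟨hq, by simp⟩ ⟨hw, by simp [dist_eq_norm]⟩
  · rw [hfq, sub_zero, Real.norm_eq_abs] at h2
    calc f w ≤ |f w| := le_abs_self _
      _ ≤ _ := h2
      _ = _ := by ring
  · have h3 : ‖fderiv ℝ f x‖ = ‖gradient f x‖ := by simp [gradient]
    rw [h3]
    refine (hM x hx.1).trans (mul_le_mul_of_nonneg_left ?_ hM0)
    simpa [dist_eq_norm] using hx.2

theorem half_mul_norm_sub_sq_le {f : E → ℝ} (hf : ContDiff ℝ ∞ f) {k : ℝ} {q z : E}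
    (hfq : f q = 0)
    (hk : ∀ s ∈ Set.Icc (0 : ℝ) 1, k * s * ‖z‖ ^ 2 ≤ inner ℝ (gradient f (q + s • z)) z) :
    k / 2 * ‖z‖ ^ 2 ≤ f (q + z) := by
  have hl : ∀ s : ℝ, HasDerivAt (fun s : ℝ => q + s • z) z s := fun s => by
    simpa using ((hasDerivAt_id s).smul_const z).const_add q
  have hd : ∀ s : ℝ, HasDerivAt (fun s : ℝ => f (q + s • z) - k / 2 * ‖z‖ ^ 2 * s ^ 2)
      (inner ℝ (gradient f (q + s • z)) z - k * s * ‖z‖ ^ 2) s := fun s => by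
    have h1 := ((hf.differentiable (by simp)) _).hasFDerivAt.comp_hasDerivAt s (hl s)
    rw [inner_gradient]
    refine (h1.sub (((hasDerivAt_id s).pow 2).const_mul (k / 2 * ‖z‖ ^ 2))).congr_deriv ?_
    simp
    ring
  have hmono : MonotoneOn (fun s : ℝ => f (q + s • z) - k / 2 * ‖z‖ ^ 2 * s ^ 2)
      (Set.Icc 0 1) := by
    refine monotoneOn_of_hasDerivWithinAt_nonneg (convex_Icc 0 1)
      (fun u _ => (hd u).continuousAt.continuousWithinAt)
      (fun u _ => (hd u).hasDerivWithinAt) fun u hu => ?_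
    exact sub_nonneg.2 (hk u (interior_subset hu))
  have h1 := hmono (Set.left_mem_Icc.2 zero_le_one) (Set.right_mem_Icc.2 zero_le_one) zero_le_one
  simp [hfq] at h1
  linarith

end Segment

variable {E : Type*} [NormedAddCommGroup E] [InnerProductSpace ℝ E] [FiniteDimensional ℝ E]

/-- Near a zero `p` of a non-negative Morse–Bott function `f` with zero set a submanifold: a
Polyak–Łojasiewicz inequality, and a bound for the part of the gradient along the tangent space. -/
theorem exists_eventually_gradient_estimates {f : E → ℝ} (hf : IsMorseBott f)
    (hf0 : ∀ x, 0 ≤ f x) (hN : IsSubmanifold (f ⁻¹' {0})) {p : E} (hp : f p = 0) :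
    ∃ κ > 0, ∃ C ≥ 0, ∀ᶠ w in 𝓝 p, κ * f w ≤ ‖gradient f w‖ ^ 2 ∧
      ‖(tangentSpace (f ⁻¹' {0}) p).starProjection (gradient f w)‖ ≤
        C * (√(f w) * ‖(tangentSpace (f ⁻¹' {0}) p).starProjection (w - p)‖ + f w) ∧
      f w ≤ C * ‖w - p‖ ^ 2 := by
  have hsm := hf.1
  obtain ⟨c, hc, hHess⟩ := exists_pos_mul_sq_le_hessian hf hf0 hp
  have hcrit : ∀ q, f q = 0 → fderiv ℝ f q = 0 := fun q hq =>
    IsLocalMin.fderiv_eq_zero (Eventually.of_forall fun x => hq.trans_le (hf0 x))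
  have hgrad : ∀ q, f q = 0 → gradient f q = 0 := fun q hq =>
    (gradient_eq_zero_iff f q).2 (hcrit q hq)
  set T := tangentSpace (f ⁻¹' {0}) p with hT
  set A := fderiv ℝ (gradient f) p with hA
  have hAT : ∀ v ∈ T, A v = 0 := by
    intro v hv
    refine ext_inner_right ℝ fun w => ?_
    rw [hA, inner_fderiv_gradient hsm,
      fderiv_fderiv_eq_zero_of_mem_tangentSpace hsm (fun q hq => hcrit q hq) hv]
    simp
  -- By symmetry of the Hessian, the range of `A` is orthogonal to its kernel, which contains `T`.
  have hTA : ∀ v, T.starProjection (A v) = 0 := by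
    intro v
    rw [Submodule.starProjection_apply_eq_zero_iff, Submodule.mem_orthogonal']
    intro u hu
    have h := hAT u hu
    rw [hA, inner_fderiv_gradient hsm, fderiv_fderiv_symm hsm, ← inner_fderiv_gradient hsm, ← hA,
      h, inner_zero_left]
  have hAc : ∀ v ∈ Tᗮ, c * ‖v‖ ^ 2 ≤ inner ℝ (A v) v := fun v hv => by
    rw [hA, inner_fderiv_gradient hsm]
    exact hHess v hv
  obtain ⟨L, hL, r₀, hr₀, hLip⟩ := exists_norm_sub_sub_fderiv_le (contDiff_gradient hsm) p
  -- The bound `c / 4` lets coercivity absorb the linearization error; the bound 1 yields the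
  -- Lipschitz constant `‖A‖ + 1`.
  obtain ⟨r, hr, hrr₀, hrc, hr1⟩ : ∃ r > 0, r ≤ r₀ ∧ L * r ≤ c / 4 ∧ L * r ≤ 1 := by
    have h1 : Tendsto (fun r : ℝ => L * r) (𝓝[>] 0) (𝓝 0) := by
      have : Continuous fun r : ℝ => L * r := by fun_prop
      simpa using (this.tendsto 0).mono_left nhdsWithin_le_nhds
    have h2 : ∀ᶠ r in 𝓝[>] (0 : ℝ), r < r₀ :=
      (eventually_lt_nhds hr₀).filter_mono nhdsWithin_le_nhds
    obtain ⟨r, ⟨⟨h3, h4⟩, h5⟩, h6⟩ := (((h2.and (h1.eventually_lt_const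
      (show (0 : ℝ) < c / 4 by positivity))).and (h1.eventually_lt_const one_pos)).and
        self_mem_nhdsWithin).exists
    exact ⟨r, h6, h3.le, h4.le, h5.le⟩
  have hpr : p ∈ Metric.closedBall p r := Metric.mem_closedBall_self hr.le
  have hM : ∀ q ∈ Metric.closedBall p r, f q = 0 → ∀ y ∈ Metric.closedBall p r,
      ‖gradient f y‖ ≤ (‖A‖ + 1) * ‖y - q‖ := by
    intro q hq hfq y hy
    have h1 := hLip r hrr₀ y hy q hq
    rw [hgrad q hfq, sub_zero] at h1
    have h2 := A.le_opNorm (y - q)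
    have h3 := norm_sub_norm_le (gradient f y) (A (y - q))
    have h4 := mul_le_mul_of_nonneg_right hr1 (norm_nonneg (y - q))
    rw [add_mul]
    linarith
  -- The gradient vanishes at both `q` and `p`, so `A (q - p)` is small; coercivity then makes the
  -- normal part at most a quarter of `‖q - p‖`.
  have hQP : ∀ q ∈ Metric.closedBall p r, f q = 0 →
      ‖q - p‖ ≤ 2 * ‖T.starProjection (q - p)‖ := by
    intro q hq hfq
    have h1 := hLip r hrr₀ q hq p hpr
    rw [hgrad q hfq, hgrad p hp, sub_zero, zero_sub, norm_neg, ← hA] at h1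
    set u := q - p with hu
    set y := u - T.starProjection u with hy
    have h2 : c * ‖y‖ ^ 2 ≤ inner ℝ (A y) y :=
      hAc y (Submodule.sub_starProjection_mem_orthogonal u)
    have h3 : A y = A u := by
      rw [hy, map_sub, hAT _ (T.starProjection_apply_mem u), sub_zero]
    have h4 : inner ℝ (A u) y ≤ c / 4 * ‖u‖ * ‖y‖ :=
      (real_inner_le_norm _ _).trans (mul_le_mul_of_nonneg_right
        (h1.trans (mul_le_mul_of_nonneg_right hrc (norm_nonneg _))) (norm_nonneg _))
    have h5 : ‖u‖ ≤ ‖T.starProjection u‖ + ‖y‖ := by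
      have := norm_add_le (T.starProjection u) y
      rwa [hy, add_sub_cancel] at this
    have h6 : ‖y‖ ≤ ‖u‖ / 4 := by
      by_contra! h
      rw [h3] at h2
      have h7 : 0 < ‖y‖ := (div_nonneg (norm_nonneg u) zero_le_four).trans_lt h
      have h8 : 0 < c * ‖y‖ := by positivity
      nlinarith
    linarith [norm_nonneg u]
  -- The first constant combines `hgz` with `hup`. The second is a sum, so that it serves both
  -- remaining bounds.
  refine ⟨(3 * c / 4) ^ 2 / (‖A‖ + 1), by positivity,
    2 * L * √(8 / (3 * c)) + L * (8 / (3 * c)) + (‖A‖ + 1), by positivity, ?_⟩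
  filter_upwards [hN.eventually_exists_sub_mem_orthogonal hp (Metric.closedBall_mem_nhds p hr),
    Metric.closedBall_mem_nhds p hr] with w hw hwr
  obtain ⟨q, ⟨hfq, hqr⟩, hz⟩ := hw
  change f q = 0 at hfq
  rw [← hT] at hz
  set z := w - q with hzdef
  have hwq : w = q + z := by simp [hzdef]
  have hinner : ∀ s ∈ Set.Icc (0 : ℝ) 1,
      3 * c / 4 * s * ‖z‖ ^ 2 ≤ inner ℝ (gradient f (q + s • z)) z := by
    intro s hs
    have hmem : q + s • z ∈ Metric.closedBall p r :=
      (convex_closedBall p r).add_smul_sub_mem hqr hwr hs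
    have h1 := hLip r hrr₀ _ hmem q hqr
    rw [hgrad q hfq, sub_zero, add_sub_cancel_left, ← hA, map_smul, norm_smul, Real.norm_eq_abs,
      abs_of_nonneg hs.1] at h1
    have h2 := (abs_le.1 (abs_real_inner_le_norm (gradient f (q + s • z) - s • A z) z)).1
    rw [inner_sub_left, real_inner_smul_left] at h2
    have h3 : ‖gradient f (q + s • z) - s • A z‖ * ‖z‖ ≤ c / 4 * (s * ‖z‖) * ‖z‖ :=
      mul_le_mul_of_nonneg_right (h1.trans (mul_le_mul_of_nonneg_right hrc
        (mul_nonneg hs.1 (norm_nonneg _)))) (norm_nonneg _)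
    have h4 := mul_le_mul_of_nonneg_left (hAc z hz) hs.1
    nlinarith
  have hlow : 3 * c / 8 * ‖z‖ ^ 2 ≤ f w := by
    have h1 := half_mul_norm_sub_sq_le hsm hfq hinner
    rw [← hwq] at h1
    linarith
  have hup : ∀ q ∈ Metric.closedBall p r, f q = 0 → f w ≤ (‖A‖ + 1) * ‖w - q‖ ^ 2 :=
    fun q hq hfq => le_mul_norm_sub_sq hsm (convex_closedBall p r) hq hwr hfq (by positivity)
      (hM q hq hfq)
  have hgz : 3 * c / 4 * ‖z‖ ≤ ‖gradient f w‖ := by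
    rcases (norm_nonneg z).eq_or_lt with h0 | h0
    · rw [← h0, mul_zero]
      exact norm_nonneg _
    · have h1 := hinner 1 (Set.right_mem_Icc.2 zero_le_one)
      rw [one_smul, ← hwq] at h1
      have h2 := real_inner_le_norm (gradient f w) z
      refine le_of_mul_le_mul_right ?_ h0
      linarith
  refine ⟨?_, ?_, ?_⟩
  · rw [div_mul_eq_mul_div, div_le_iff₀ (by positivity)]
    calc (3 * c / 4) ^ 2 * f w ≤ (3 * c / 4) ^ 2 * ((‖A‖ + 1) * ‖z‖ ^ 2) := by
          gcongr
          exact hup q hqr hfq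
      _ = (3 * c / 4 * ‖z‖) ^ 2 * (‖A‖ + 1) := by ring
      _ ≤ ‖gradient f w‖ ^ 2 * (‖A‖ + 1) := by gcongr
  · set x := ‖T.starProjection (w - p)‖ with hx
    have hx' : T.starProjection (q - p) = T.starProjection (w - p) := by
      have h1 : w - p = (q - p) + z := by rw [hwq]; abel
      rw [h1, map_add, T.starProjection_apply_eq_zero_iff.2 hz, add_zero]
    have hqx : ‖q - p‖ ≤ 2 * x := by
      have := hQP q hqr hfq
      rwa [hx'] at this
    have hwx : ‖w - p‖ ≤ 2 * x + ‖z‖ := by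
      have h1 : w - p = (q - p) + z := by rw [hwq]; abel
      rw [h1]
      exact (norm_add_le _ _).trans (by linarith)
    have hmax : max ‖w - p‖ ‖q - p‖ ≤ 2 * x + ‖z‖ :=
      max_le hwx (hqx.trans (le_add_of_nonneg_right (norm_nonneg z)))
    -- With the smallest admissible radius, the error is of order $(|\mathcal P(w-p)|+|z|)|z|$
    -- instead of $|z|$; here $|z|$ is of order at most $\sqrt{f(w)}$.
    have h1 := hLip (max ‖w - p‖ ‖q - p‖)
      (le_trans (max_le (by simpa [dist_eq_norm] using hwr) (by simpa [dist_eq_norm] using hqr))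
        hrr₀) w (by simp [dist_eq_norm]) q (by simp [dist_eq_norm])
    rw [hgrad q hfq, sub_zero, ← hA, ← hzdef] at h1
    have h2 : T.starProjection (gradient f w) = T.starProjection (gradient f w - A z) := by
      rw [map_sub, hTA, sub_zero]
    have hzf : ‖z‖ ^ 2 ≤ 8 / (3 * c) * f w := by
      rw [div_mul_eq_mul_div, le_div_iff₀ (by positivity)]
      linarith
    have hzs : ‖z‖ ≤ √(8 / (3 * c)) * √(f w) := by
      rw [← Real.sqrt_mul (by positivity)]
      exact Real.le_sqrt_of_sq_le hzf
    have hx0 : 0 ≤ x := norm_nonneg _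
    have hfw := hf0 w
    calc ‖T.starProjection (gradient f w)‖ ≤ ‖gradient f w - A z‖ := by
          rw [h2]
          exact T.norm_starProjection_apply_le _
      _ ≤ L * max ‖w - p‖ ‖q - p‖ * ‖z‖ := h1
      _ ≤ L * (2 * x + ‖z‖) * ‖z‖ := by gcongr
      _ = 2 * L * x * ‖z‖ + L * ‖z‖ ^ 2 := by ring
      _ ≤ 2 * L * x * (√(8 / (3 * c)) * √(f w)) + L * (8 / (3 * c) * f w) := by gcongr
      _ = 2 * L * √(8 / (3 * c)) * (√(f w) * x) + L * (8 / (3 * c)) * f w := by ring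
      _ ≤ _ := by
        have ha : 0 ≤ 2 * L * √(8 / (3 * c)) := by positivity
        have hb : 0 ≤ L * (8 / (3 * c)) := by positivity
        have hd : 0 ≤ ‖A‖ + 1 := by positivity
        have he : 0 ≤ √(f w) * x := by positivity
        nlinarith [mul_nonneg ha hfw, mul_nonneg hb he, mul_nonneg hd he, mul_nonneg hd hfw]
  · refine (hup p hpr hp).trans (mul_le_mul_of_nonneg_right ?_ (by positivity))
    exact le_add_of_nonneg_left (by positivity)

end LocalEstimates

/-! ### Gradient flow lines -/

section Flow

variable {E : Type*} [NormedAddCommGroup E] [InnerProductSpace ℝ E]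

/-- ODE uniqueness against the constant solution. The gradient is only locally Lipschitz, so the
argument runs on a compact time interval around both times, whose image is compact. -/
theorem IsGradientFlow.eq_of_gradient_eq_zero [CompleteSpace E] {f : E → ℝ} (hf : ContDiff ℝ ∞ f)
    {γ : ℝ → E} {a : EReal} (hγ : IsGradientFlow f γ a ⊤) {t₀ : ℝ} (ht₀ : a < t₀)
    (hcrit : gradient f (γ t₀) = 0) {t : ℝ} (ht : a < t) : γ t = γ t₀ := by
  obtain ⟨l, hal, hl⟩ := EReal.lt_iff_exists_real_btwn.1 (lt_min ht ht₀)
  obtain ⟨hlt, hlt₀⟩ := lt_min_iff.1 hl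
  rw [EReal.coe_lt_coe_iff] at hlt hlt₀
  set u := max t t₀ + 1 with hu
  have htu : t < u := (le_max_left _ _).trans_lt (lt_add_one _)
  have ht₀u : t₀ < u := (le_max_right _ _).trans_lt (lt_add_one _)
  have hd : ∀ s ∈ Set.Icc l u, HasDerivAt γ (-gradient f (γ s)) s := fun s hs =>
    hγ.hasDerivAt s (hal.trans_le (EReal.coe_le_coe_iff.2 hs.1)) (EReal.coe_lt_top s)
  have hK : IsCompact (γ '' Set.Icc l u) :=
    isCompact_Icc.image_of_continuousOn fun s hs => (hd s hs).continuousAt.continuousWithinAt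
  have hG : ContDiff ℝ 1 fun x => -gradient f x := (contDiff_gradient hf).neg.of_le (by simp)
  obtain ⟨K, hKL⟩ := hG.locallyLipschitz.locallyLipschitzOn.exists_lipschitzOnWith_of_compact hK
  exact ODE_solution_unique_of_mem_Ioo (v := fun _ x => -gradient f x) (g := fun _ => γ t₀)
    (s := fun _ => γ '' Set.Icc l u) (fun _ _ => hKL) ⟨hlt₀, ht₀u⟩
    (fun s hs => ⟨hd s (Set.Ioo_subset_Icc_self hs),
      Set.mem_image_of_mem γ (Set.Ioo_subset_Icc_self hs)⟩)
    (fun s _ => ⟨by simpa [hcrit] using hasDerivAt_const s (γ t₀),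
      Set.mem_image_of_mem γ ⟨hlt₀.le, ht₀u.le⟩⟩) rfl ⟨hlt, htu⟩

variable [FiniteDimensional ℝ E]

theorem IsGradientFlow.exists_eventually_norm_starProjection_le {f : E → ℝ} (hf : IsMorseBott f)
    (hf0 : ∀ x, 0 ≤ f x) (hN : IsSubmanifold (f ⁻¹' {0})) {γ : ℝ → E} {a : EReal}
    (hγ : IsGradientFlow f γ a ⊤) {p : E} (hp : f p = 0) (hlim : Tendsto γ atTop (𝓝 p)) :
    ∃ C : ℝ, ∀ᶠ t in atTop, ‖(tangentSpace (f ⁻¹' {0}) p).starProjection (γ t - p)‖ ≤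
      C * ‖γ t - p - (tangentSpace (f ⁻¹' {0}) p).starProjection (γ t - p)‖ ^ 2 := by
  obtain ⟨κ, hκ, C, hC, hest⟩ := exists_eventually_gradient_estimates hf hf0 hN hp
  set T := tangentSpace (f ⁻¹' {0}) p with hT
  have ha : ∀ᶠ t : ℝ in atTop, a < t := by
    obtain ⟨m, ham, -⟩ := EReal.lt_iff_exists_real_btwn.1 hγ.lt
    filter_upwards [eventually_ge_atTop m] with t ht
      using ham.trans_le (EReal.coe_le_coe_iff.2 ht)
  obtain ⟨t₀, ht₀⟩ := eventually_atTop.1 (ha.and (hlim.eventually hest))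
  have hd : ∀ t ≥ t₀, HasDerivAt γ (-gradient f (γ t)) t := fun t ht =>
    hγ.hasDerivAt t (ht₀ t ht).1 (EReal.coe_lt_top t)
  have hflim : Tendsto (fun t => f (γ t)) atTop (𝓝 0) := by
    have h := (hf.1.continuous.tendsto p).comp hlim
    rwa [hp] at h
  have hXlim : Tendsto (fun t => T.starProjection (γ t - p)) atTop (𝓝 0) := by
    have h := (T.starProjection.continuous.tendsto (p - p)).comp (hlim.sub_const p)
    rwa [sub_self, map_zero] at h
  obtain ⟨K, hK, hKev⟩ := exists_eventually_norm_le_mul (φ := fun t => f (γ t))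
    (φ' := fun t => -‖gradient f (γ t)‖ ^ 2) (X := fun t => T.starProjection (γ t - p))
    (X' := fun t => T.starProjection (-gradient f (γ t))) hκ hC (fun t => hf0 _)
    (fun t ht => by
      refine (((hf.1.differentiable (by simp)) _).hasFDerivAt.comp_hasDerivAt t
        (hd t ht)).congr_deriv ?_
      rw [← inner_gradient, inner_neg_right, real_inner_self_eq_norm_sq])
    (fun t ht => by
      have := (ht₀ t ht).2.1
      linarith)
    (fun t ht => T.starProjection.hasFDerivAt.comp_hasDerivAt t ((hd t ht).sub_const p))
    (fun t ht => by
      rw [map_neg, norm_neg]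
      exact (ht₀ t ht).2.2.1) hflim hXlim
  -- From $x\le 2KCx^2+2KCy^2$ and $2KCx<1/2$ follows $x\le 4KCy^2$.
  refine ⟨4 * (K * C), ?_⟩
  have hsmall : ∀ᶠ t in atTop, 2 * (K * C) * ‖T.starProjection (γ t - p)‖ < 1 / 2 := by
    have h1 : Tendsto (fun t => 2 * (K * C) * ‖T.starProjection (γ t - p)‖) atTop (𝓝 0) := by
      simpa using hXlim.norm.const_mul (2 * (K * C))
    exact h1.eventually_lt_const (by norm_num)
  filter_upwards [hKev, hsmall, eventually_ge_atTop t₀] with t h1 h2 h3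
  have h4 := (ht₀ t h3).2.2.2
  have h5 : ‖γ t - p‖ ≤ ‖T.starProjection (γ t - p)‖ +
      ‖γ t - p - T.starProjection (γ t - p)‖ := by
    simpa using norm_add_le (T.starProjection (γ t - p)) (γ t - p - T.starProjection (γ t - p))
  set x := ‖T.starProjection (γ t - p)‖
  set y := ‖γ t - p - T.starProjection (γ t - p)‖
  have hx : 0 ≤ x := norm_nonneg _
  have hKC : 0 ≤ K * C := mul_nonneg hK hC
  have h6 : x ≤ K * C * (x + y) ^ 2 := by
    calc x ≤ K * f (γ t) := h1
      _ ≤ K * (C * ‖γ t - p‖ ^ 2) := by gcongr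
      _ ≤ K * (C * (x + y) ^ 2) := by gcongr
      _ = _ := by ring
  have h7 : K * C * (x + y) ^ 2 ≤ K * C * (2 * x ^ 2 + 2 * y ^ 2) :=
    mul_le_mul_of_nonneg_left (by nlinarith [sq_nonneg (x - y)]) hKC
  have h8 := mul_le_mul_of_nonneg_right h2.le hx
  nlinarith

end Flow

end MorseBott

/-! ### The main theorem -/

theorem mainTheorem2 (n : ℕ) (f : EuclideanSpace ℝ (Fin n) → ℝ)
    (hf : MorseBott.IsMorseBott f) (hf_nonneg : ∀ x, 0 ≤ f x)
    (hN_nonempty : (f ⁻¹' {0}).Nonempty) (hN : MorseBott.IsSubmanifold (f ⁻¹' {0}))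
    (a : EReal) (γ : ℝ → EuclideanSpace ℝ (Fin n)) (hγ : MorseBott.IsGradientFlow f γ a ⊤)
    (p : EuclideanSpace ℝ (Fin n)) (hp : p ∈ f ⁻¹' {0}) (hlim : Tendsto γ atTop (𝓝 p))
    (P Q : EuclideanSpace ℝ (Fin n) →L[ℝ] EuclideanSpace ℝ (Fin n))
    (hP : P = (MorseBott.tangentSpace (f ⁻¹' {0}) p).starProjection)
    (hQ : Q = ContinuousLinearMap.id ℝ (EuclideanSpace ℝ (Fin n)) - P) :
    (∃ C : ℝ, ∀ᶠ t in atTop, ‖P (γ t - p)‖ ≤ C * ‖Q (γ t - p)‖ ^ 2) ∧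
      ((∃ s t : ℝ, a < (s : EReal) ∧ a < (t : EReal) ∧ γ s ≠ γ t) →
        (∀ᶠ t in atTop, Q (γ t - p) ≠ 0) ∧
          limsup (fun t : ℝ => ((‖P (γ t - p)‖ / ‖Q (γ t - p)‖ ^ 2 : ℝ) : EReal)) atTop < ⊤) := by
  have hQv : ∀ v, Q v = v - P v := fun v => by simp [hQ]
  obtain ⟨C, hC⟩ : ∃ C : ℝ, ∀ᶠ t in atTop, ‖P (γ t - p)‖ ≤ C * ‖Q (γ t - p)‖ ^ 2 := by
    simp only [hQv, hP]
    exact hγ.exists_eventually_norm_starProjection_le hf hf_nonneg hN hp hlim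
  refine ⟨⟨C, hC⟩, ?_⟩
  rintro ⟨s, t, hs, ht, hst⟩
  have ha : ∀ᶠ t : ℝ in atTop, a < t := by
    filter_upwards [eventually_ge_atTop s] with t ht
      using hs.trans_le (EReal.coe_le_coe_iff.2 ht)
  have hne : ∀ᶠ t in atTop, Q (γ t - p) ≠ 0 := by
    filter_upwards [hC, ha] with u hu hau h0
    -- Once the normal part vanishes, the quadratic bound kills the tangential part too.
    rw [h0, norm_zero, zero_pow two_ne_zero, mul_zero, norm_le_zero_iff] at hu
    have hup : γ u = p := by
      rw [hQv, hu, sub_zero] at h0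
      exact sub_eq_zero.1 h0
    have hcrit : gradient f (γ u) = 0 := by
      rw [hup, MorseBott.gradient_eq_zero_iff]
      have hfp : f p = 0 := hp
      exact IsLocalMin.fderiv_eq_zero
        (Eventually.of_forall fun x => hfp.trans_le (hf_nonneg x))
    exact hst ((hγ.eq_of_gradient_eq_zero hf.1 hau hcrit hs).trans
      (hγ.eq_of_gradient_eq_zero hf.1 hau hcrit ht).symm)
  refine ⟨hne, lt_of_le_of_lt (limsup_le_of_le (a := (C : EReal)) ?_ ?_) (EReal.coe_lt_top C)⟩
  · isBoundedDefault
  · filter_upwards [hC, hne] with u hu hu0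
    rw [EReal.coe_le_coe_iff]
    exact (div_le_iff₀ (pow_pos (norm_pos_iff.2 hu0) 2)).2 hu
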